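/- **Setting.** Fix a set of constants and a family $\Delta$ of parameterized discrete distributions: each $\delta\in\Delta$ maps a tuple $\bar p$ of constants to a probability mass function $\delta\langle\bar p\rangle$ on constants. A GDatalog$^\neg[\Delta]$ program $\Pi$ is a finite set of safe rules $R_1(\bar u_1),\dots,R_n(\bar u_n),\neg P_1(\bar v_1),\dots,\neg P_m(\bar v_m)\to R_0(\bar w)$, where $\bar w$ may contain $\Delta$-terms $\delta\langle\bar p\rangle[\bar q]$. Let $D$ be a finite set of facts over the predicates of $\Pi$ that occur in no rule head, and let $\Pi[D]=\Pi\cup\{\to\alpha\mid\alpha\in D\}$. Each rule of $\Pi[D]$ with body $B$ and head $\Delta$-terms $\delta_j\langle\bar p_j\rangle[\bar q_j]$, $j=1,\dots,r$, is translated into $B\to\mathrm{Active}^{\delta_j}_{|\bar q_j|}(\bar p_j,\bar q_j)$, $\ \mathrm{Active}^{\delta_j}_{|\bar q_j|}(\bar p_j,\bar q_j)\to\exists y\,\mathrm{Result}^{\delta_j}_{|\bar q_j|}(\bar p_j,\bar q_j,y)$ and $\mathrm{Result}^{\delta_1}_{|\bar q_1|}(\bar p_1,\bar q_1,y_1),\dots,\mathrm{Result}^{\delta_r}_{|\bar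 q_r|}(\bar p_r,\bar q_r,y_r),B\to R_0(\bar w')$, where $\bar w'$ is $\bar w$ with the $\Delta$-terms replaced by the $y_j$. Let $\Sigma^{\exists}$ and $\Sigma^{\not\exists}$ be the sets of translated rules with and without $\exists$. A *choice set* is a set $\Sigma$ of ground instances of $\Sigma^\exists$ that maps no Active atom to two Result atoms; it is *compatible* with a ground program $\Gamma$ if it is defined on every Active atom that is a head of $\Gamma$. Write $\mathsf{sms}$ for the set of stable models. A *grounder* $G$ of $\Pi[D]$ is a monotone map from choice sets to sets of ground instances of $\Sigma^{\not\exists}$ such that $\mathsf{sms}(G(\Sigma)\cup\Sigma)=\mathsf{sms}(\Sigma^{\not\exists}\cup\Sigma')$ whenever $\Sigma$ is compatible with $G(\Sigma)$ and $\Sigma'\supseteq\Sigma$ is a choice set that is defined on all Active atoms occurring in ground instances of $\Sigma^\exists$. **Declarative space** $\Pi_G(D)$. The possible outcomes, forming $\Omega$, are the programs $\Sigma\cup G(\Sigma)$, with $\Sigma$ an inclusion-minimal choice set among those that are compatible with $G(\Sigma)$, in which every head $\mathrm{Result}^\delta_n(\bar p,\bar q,o)$ has $\delta\langle\bar p\rangle(o)>0$.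 Let $\Omega^{\mathrm{fin}}$ be the set of finite ones and $\Omega^\infty$ its complement in $\Omega$. The $\sigma$-algebra $\mathcal F$ is generated by $\Omega^\infty$ and the maximal sets $E\subseteq\Omega^{\mathrm{fin}}$ of outcomes with the same stable models. The measure $P$ satisfies $P(E)=\sum_{\Gamma\in E}\mathrm{Pr}(\Gamma)$ for these $E$ and $P(\Omega^\infty)=1-\sum_{\Gamma\in\Omega^{\mathrm{fin}}}\mathrm{Pr}(\Gamma)$, where $\mathrm{Pr}(\Gamma)$ is the product of $\delta\langle\bar p\rangle(o)$ over all heads $\mathrm{Result}^\delta_n(\bar p,\bar q,o)$ of $\Gamma$. **Chase.** A chase tree $T$ is a rooted, possibly infinite tree with nodes labelled by choice sets, the root by $\emptyset$. The children of a non-leaf labelled $\Sigma$ are labelled, bijectively, by the sets $\Sigma\cup\{\alpha\to\mathrm{Result}^\delta_{|\bar q|}(\bar p,\bar q,o)\}$ with $\delta\langle\bar p\rangle(o)>0$, for some trigger $\alpha=\mathrm{Active}^\delta_{|\bar q|}(\bar p,\bar q)$, i.e. an Active atom that is a head of $G(\Sigma)$ and on which $\Sigma$ is undefined. At a leaf there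 is no trigger. For a maximal path $\pi$ of finite length let $[\![\pi]\!]$ be the label of its leaf and $[\![\pi]\!]_G=[\![\pi]\!]\cup G([\![\pi]\!])$. Call $\pi$ *finite* if it has finite length and $[\![\pi]\!]_G$ is finite. Let $\mathsf{paths}^{\mathrm{fin}}(T)$ be the set of finite paths and $\mathsf{paths}^\infty(T)$ the set of all other maximal paths. On the set of all maximal paths, the $\sigma$-algebra $\mathcal F_T$ is generated by $\mathsf{paths}^\infty(T)$ and the maximal sets of finite paths $\pi$ with the same $\mathsf{sms}([\![\pi]\!]_G)$. The measure $P_T$ gives such a set $E$ the value $\sum_{\pi\in E}\mathrm{Pr}([\![\pi]\!])$, and $\mathsf{paths}^\infty(T)$ the remaining mass. **Theorem.** For every program $\Pi$, database $D$, grounder $G$ of $\Pi[D]$ and chase tree $T$ as above: 1. $\pi\mapsto[\![\pi]\!]_G$ is a bijection from $\mathsf{paths}^{\mathrm{fin}}(T)$ onto $\Omega^{\mathrm{fin}}$. 2. $P$ and $P_T$ are probability measures. 3. The map sending $A\in\mathcal F_T$ to $\{[\![\pi]\!]_G\mid\pi\in A\cap\mathsf{paths}^{\mathrm{fin}}(T)\}$,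 together with $\Omega^\infty$ if $A$ meets $\mathsf{paths}^\infty(T)$, is an isomorphism of $\sigma$-algebras from $\mathcal F_T$ onto $\mathcal F$, and it carries $P_T$ to $P$. 4. If $G$ maps finite choice sets to finite sets, then every maximal path of finite length is finite. -/

import Mathlib

open MeasureTheory
open scoped ENNReal

universe u v w

namespace GDatalog

/-- The vocabulary over a set `C` of constants: relation symbols with their arities, and a set
`Δ` of parameterized discrete probability distributions. The distribution `dist δ p` is a
probability mass function on constants; its support, hence its sample space, is countable.
Numerical parameters and outcomes are among the constants. -/
structure Vocabulary (C : Type u) where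
  Rel : Type v
  arity : Rel → ℕ
  Dist : Type w
  pdim : Dist → ℕ
  dist : (δ : Dist) → (Fin (pdim δ) → C) → PMF C

/-- Terms: constants or variables, the variables being taken from `X`. -/
inductive Term (C : Type u) (X : Type) where
  | const (c : C)
  | var (x : X)

namespace Term

variable {C : Type u} {X Y : Type}

/-- The value of a term under an assignment of constants to the variables. -/
def eval (h : X → C) : Term C X → C
  | const c => c
  | var x => h x

/-- Renaming of variables. -/
def rename (f : X → Y) : Term C X → Term C Y
  | const c => const c
  | var x => var (f x)

end Term

variable {C : Type u}

/-- An ordinary atom `R(t₁, …, tₙ)`; its variables are natural numbers. -/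
structure Atom (L : Vocabulary.{u, v, w} C) where
  rel : L.Rel
  args : Fin (L.arity rel) → Term C ℕ

/-- A `Δ`-term `δ⟨p⟩[q]`, with parameters `p` and event signature `q` (possibly empty). -/
structure DTerm (L : Vocabulary.{u, v, w} C) where
  dist : L.Dist
  param : Fin (L.pdim dist) → Term C ℕ
  sig : List (Term C ℕ)

/-- The entries of a rule head: ordinary terms or `Δ`-terms. -/
inductive HeadTerm (L : Vocabulary.{u, v, w} C) where
  | term (t : Term C ℕ)
  | dterm (d : DTerm L)

/-- The variable `x` occurs in the given head entry. -/
def HeadTerm.HasVar {L : Vocabulary.{u, v, w} C} (x : ℕ) : HeadTerm L → Prop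
  | .term t => t = .var x
  | .dterm d => (∃ i, d.param i = .var x) ∨ .var x ∈ d.sig

/-- A rule `R₁(u₁), …, Rₙ(uₙ), ¬P₁(v₁), …, ¬Pₘ(vₘ) → R₀(w)` of generative Datalog with
negation: `Δ`-terms are allowed in the head, and every variable of the rule occurs in some
positive body atom. -/
structure Rule (L : Vocabulary.{u, v, w} C) where
  pos : Finset (Atom L)
  neg : Finset (Atom L)
  headRel : L.Rel
  headArgs : Fin (L.arity headRel) → HeadTerm L
  safe_neg : ∀ a ∈ neg, ∀ i x, a.args i = .var x → ∃ b ∈ pos, ∃ j, b.args j = .var x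
  safe_head : ∀ i x, (headArgs i).HasVar x → ∃ b ∈ pos, ∃ j, b.args j = .var x

/-- A fact `R(c₁, …, cₙ)`, with constant entries. -/
structure Fact (L : Vocabulary.{u, v, w} C) where
  rel : L.Rel
  args : Fin (L.arity rel) → C

/-- The extensional predicates of a program: those occurring in it, but in no rule head. -/
def edb {L : Vocabulary.{u, v, w} C} (P : Set (Rule L)) : Set L.Rel :=
  {R | (∃ ρ ∈ P, ∃ a : Atom L, (a ∈ ρ.pos ∨ a ∈ ρ.neg) ∧ a.rel = R) ∧ ∀ ρ ∈ P, ρ.headRel ≠ R}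

/-- The rule `→ α` of a fact `α`. -/
def Fact.toRule {L : Vocabulary.{u, v, w} C} (α : Fact L) : Rule L where
  pos := ∅
  neg := ∅
  headRel := α.rel
  headArgs := fun i => .term (.const (α.args i))
  safe_neg := by simp
  safe_head := by simp [HeadTerm.HasVar]

/-- The program `P[D]`: the rules of `P` together with `→ α` for every fact `α` of `D`. -/
def withDatabase {L : Vocabulary.{u, v, w} C} (P : Set (Rule L)) (D : Set (Fact L)) :
    Set (Rule L) :=
  P ∪ Fact.toRule '' D

/-- Atoms over the extended schema, with entries in `A`: ordinary atoms, and for every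
distribution `δ` and every length of the event signature `q` the fresh predicates
`Active(p, q)` and `Result(p, q, y)`. -/
inductive XAtom (L : Vocabulary.{u, v, w} C) (A : Type u) where
  | rel (R : L.Rel) (t : Fin (L.arity R) → A)
  | active (δ : L.Dist) (p : Fin (L.pdim δ) → A) (q : List A)
  | result (δ : L.Dist) (p : Fin (L.pdim δ) → A) (q : List A) (y : A)

/-- Apply a map to all the entries of an atom. -/
def XAtom.map {L : Vocabulary.{u, v, w} C} {A B : Type u} (f : A → B) : XAtom L A → XAtom L B
  | .rel R t => .rel R (fun i => f (t i))
  | .active δ p q => .active δ (fun i => f (p i)) (q.map f)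
  | .result δ p q y => .result δ (fun i => f (p i)) (q.map f) (f y)

/-- A TGD with negation and a single head atom, with entries in `A`. Variables that occur only
in the head are existentially quantified. With `A = C` it is ground. -/
@[ext]
structure TGD (L : Vocabulary.{u, v, w} C) (A : Type u) where
  pos : Set (XAtom L A)
  neg : Set (XAtom L A)
  head : XAtom L A

/-- Apply a map to all the entries of a TGD. -/
def TGD.map {L : Vocabulary.{u, v, w} C} {A B : Type u} (f : A → B) (σ : TGD L A) : TGD L B where
  pos := XAtom.map f '' σ.pos
  neg := XAtom.map f '' σ.neg
  head := σ.head.map f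

/-- Ground atoms. -/
abbrev GAtom (L : Vocabulary.{u, v, w} C) := XAtom L C

/-- Ground TGDs. -/
abbrev GTGD (L : Vocabulary.{u, v, w} C) := TGD L C

/-- Variables of the translated program: `inl x` is the variable `x` of the rule, and `inr i` is
the fresh variable standing for the outcome of the `Δ`-term at position `i` of the head. -/
abbrev XVar := ℕ ⊕ ℕ

/-- The set of all ground instances of a set of TGDs, all the variables (existentially
quantified ones included) being replaced by constants. -/
def ground {L : Vocabulary.{u, v, w} C} (S : Set (TGD L (Term C XVar))) : Set (GTGD L) :=
  {τ | ∃ σ ∈ S, ∃ h : XVar → C, τ = σ.map (Term.eval h)}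

/-- An ordinary atom as an atom over the extended schema. -/
def Atom.toX {L : Vocabulary.{u, v, w} C} (a : Atom L) : XAtom L (Term C XVar) :=
  .rel a.rel (fun i => (a.args i).rename Sum.inl)

/-- The atom `Active(p, q)` of a `Δ`-term. -/
def DTerm.active {L : Vocabulary.{u, v, w} C} (d : DTerm L) : XAtom L (Term C XVar) :=
  .active d.dist (fun i => (d.param i).rename Sum.inl) (d.sig.map (Term.rename Sum.inl))

/-- The atom `Result(p, q, yᵢ)` of a `Δ`-term at position `i`. -/
def DTerm.result {L : Vocabulary.{u, v, w} C} (d : DTerm L) (i : ℕ) : XAtom L (Term C XVar) :=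
  .result d.dist (fun j => (d.param j).rename Sum.inl) (d.sig.map (Term.rename Sum.inl))
    (.var (Sum.inr i))

/-- The head entry at position `i`, a `Δ`-term being replaced by the fresh variable `yᵢ`. -/
def HeadTerm.toX {L : Vocabulary.{u, v, w} C} (i : ℕ) : HeadTerm L → Term C XVar
  | .term t => t.rename Sum.inl
  | .dterm _ => .var (Sum.inr i)

namespace Rule

variable {L : Vocabulary.{u, v, w} C}

/-- `B → Active(p, q)`, for a `Δ`-term `δ⟨p⟩[q]` of the head. -/
def activeTGD (ρ : Rule L) (d : DTerm L) : TGD L (Term C XVar) where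
  pos := Atom.toX '' ρ.pos
  neg := Atom.toX '' ρ.neg
  head := d.active

/-- `Result(p₁, q₁, y₁), …, Result(pᵣ, qᵣ, yᵣ), B → R₀(w')`, where `w'` is obtained from `w` by
replacing the `Δ`-terms by the `yᵢ`; it is `B → R₀(w)` if there are no `Δ`-terms. -/
def mainTGD (ρ : Rule L) : TGD L (Term C XVar) where
  pos := {a | ∃ i d, ρ.headArgs i = .dterm d ∧ a = d.result i} ∪ Atom.toX '' ρ.pos
  neg := Atom.toX '' ρ.neg
  head := .rel ρ.headRel (fun i => (ρ.headArgs i).toX i)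

/-- The active-to-result TGD `Active(p, q) → ∃ y, Result(p, q, y)` of a `Δ`-term. -/
def atrTGD (d : DTerm L) (i : ℕ) : TGD L (Term C XVar) where
  pos := {d.active}
  neg := ∅
  head := d.result i

end Rule

section Measure

variable {Ω : Type*} [MeasurableSpace Ω]

open Classical in
/-- The measure that gives every point `ω` of `F` the mass `m ω`, and the complement of `F`, which
is meant to be an atom of the σ-algebra, the remaining mass `1 - ∑ ω ∈ F, m ω`. (On an atom, the
Dirac measure at a member does not depend on the member.) -/
noncomputable def completedMeasure (F : Set Ω) (m : Ω → ℝ≥0∞) : Measure Ω :=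
  Measure.sum (fun ω : F => m ω • Measure.dirac (ω : Ω)) +
    (1 - ∑' ω : F, m ω) • (if h : Fᶜ.Nonempty then Measure.dirac h.some else 0)

theorem completedMeasure_compl {F : Set Ω} (m : Ω → ℝ≥0∞) (hF : MeasurableSet Fᶜ)
    (hne : Fᶜ.Nonempty) : completedMeasure F m Fᶜ = 1 - ∑' ω : F, m ω := by
  rw [completedMeasure, dif_pos hne, Measure.add_apply, Measure.sum_apply _ hF]
  have : ∀ ω : F, (m ω • Measure.dirac (ω : Ω)) Fᶜ = 0 := by
    intro ω
    rw [Measure.smul_apply, Measure.dirac_apply' _ hF, Set.indicator_of_notMem]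
    · simp
    · exact fun h => h ω.2
  simp only [this, tsum_zero, zero_add]
  rw [Measure.smul_apply, Measure.dirac_apply' _ hF, Set.indicator_of_mem hne.some_mem]
  simp

open Classical in
theorem completedMeasure_of_subset {F E : Set Ω} (m : Ω → ℝ≥0∞) (hE : MeasurableSet E)
    (hEF : E ⊆ F) : completedMeasure F m E = ∑' ω : E, m ω := by
  rw [completedMeasure, Measure.add_apply, Measure.sum_apply _ hE]
  have h2 : ((1 - ∑' ω : F, m ω) •
      (if h : Fᶜ.Nonempty then Measure.dirac h.some else 0 : Measure Ω)) E = 0 := by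
    split_ifs with h
    · rw [Measure.smul_apply, Measure.dirac_apply' _ hE, Set.indicator_of_notMem]
      · simp
      · exact fun h' => h.some_mem (hEF h')
    · simp
  have h3 : ∀ ω : F, (m ω • Measure.dirac (ω : Ω)) E = E.indicator m ω := by
    intro ω
    rw [Measure.smul_apply, Measure.dirac_apply' _ hE]
    by_cases h : (ω : Ω) ∈ E <;> simp [h]
  rw [h2, add_zero, tsum_congr h3, tsum_subtype F (E.indicator m), Set.indicator_indicator,
    Set.inter_eq_self_of_subset_right hEF, tsum_subtype]

end Measure

section Semantics

variable {L : Vocabulary.{u, v, w} C}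

/-- The TGDs with an existentially quantified variable in the translation of a program. -/
def exTGDs (P : Set (Rule L)) : Set (TGD L (Term C XVar)) :=
  {σ | ∃ ρ ∈ P, ∃ i d, ρ.headArgs i = .dterm d ∧ σ = Rule.atrTGD d i}

/-- The existential-free TGDs in the translation of a program. -/
def nexTGDs (P : Set (Rule L)) : Set (TGD L (Term C XVar)) :=
  {σ | ∃ ρ ∈ P, σ = ρ.mainTGD ∨ ∃ i d, ρ.headArgs i = .dterm d ∧ σ = ρ.activeTGD d}

/-- The head atoms of a ground program. -/
def heads (S : Set (GTGD L)) : Set (GAtom L) := TGD.head '' S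

/-- The instance `I` satisfies the ground TGD `σ`. -/
def Satisfies (I : Set (GAtom L)) (σ : GTGD L) : Prop :=
  σ.pos ⊆ I → Disjoint σ.neg I → σ.head ∈ I

/-- The reduct of a ground program with respect to an instance `I`: drop the TGDs with a negative
literal that is false in `I`, and the negative literals of the others. -/
def reduct (S : Set (GTGD L)) (I : Set (GAtom L)) : Set (GTGD L) :=
  {τ | ∃ σ ∈ S, Disjoint σ.neg I ∧ τ = ⟨σ.pos, ∅, σ.head⟩}

/-- The set of stable models of a ground program. -/
def sms (S : Set (GTGD L)) : Set (Set (GAtom L)) :=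
  {I | (∀ σ ∈ S, Satisfies I σ) ∧ ¬ ∃ J, J ⊂ I ∧ ∀ τ ∈ reduct S I, Satisfies J τ}

/-- The ground active-to-result TGD `Active(p, q) → Result(p, q, o)`. -/
def atr (δ : L.Dist) (p : Fin (L.pdim δ) → C) (q : List C) (o : C) : GTGD L where
  pos := {.active δ p q}
  neg := ∅
  head := .result δ p q o

/-- The partial function from `Active` atoms to `Result` atoms that is given by the set `S` of
ground active-to-result TGDs is defined on `Active(p, q)`. -/
def DefinedAt (S : Set (GTGD L)) (δ : L.Dist) (p : Fin (L.pdim δ) → C) (q : List C) : Prop :=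
  ∃ o, atr δ p q o ∈ S

/-- The functionally consistent sets of ground active-to-result TGDs of a program: no `Active`
atom is mapped to two distinct `Result` atoms. -/
@[ext]
structure Choices (P : Set (Rule L)) where
  val : Set (GTGD L)
  subset_ground : val ⊆ ground (exTGDs P)
  functional : ∀ δ p q o o', atr δ p q o ∈ val → atr δ p q o' ∈ val → o = o'

/-- `S` is compatible with the ground program `Γ`: the partial function of `S` is defined on every
`Active` atom among the heads of `Γ`. -/
def Compatible (S Γ : Set (GTGD L)) : Prop :=
  ∀ δ p q, .active δ p q ∈ heads Γ → DefinedAt S δ p q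

/-- `S'` is a totalizer of `S`: it extends `S`, and is defined on every `Active` atom that is the
body of a ground active-to-result TGD of the program. -/
def IsTotalizer {P : Set (Rule L)} (S S' : Choices P) : Prop :=
  S.val ⊆ S'.val ∧ ∀ δ p q, DefinedAt (ground (exTGDs P)) δ p q → DefinedAt S'.val δ p q

/-- A grounder of a program: a monotone map from functionally consistent sets of ground
active-to-result TGDs to sets of ground instances of the existential-free part that preserves the
stable models once the choices are compatible with the grounding. -/
structure Grounder (P : Set (Rule L)) where
  toFun : Choices P → Set (GTGD L)
  subset_ground : ∀ S, toFun S ⊆ ground (nexTGDs P)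
  monotone : ∀ S S' : Choices P, S.val ⊆ S'.val → toFun S ⊆ toFun S'
  sms_eq : ∀ S : Choices P, Compatible S.val (toFun S) → ∀ S' : Choices P, IsTotalizer S S' →
    sms (toFun S ∪ S.val) = sms (ground (nexTGDs P) ∪ S'.val)

variable {P : Set (Rule L)}

namespace Grounder

/-- The ground program obtained from a set of choices. -/
def program (G : Grounder P) (S : Choices P) : Set (GTGD L) := S.val ∪ G.toFun S

/-- The terminals of a grounder. -/
def IsTerminal (G : Grounder P) (S : Choices P) : Prop := Compatible S.val (G.toFun S)

/-- The grounding of the program relative to `G`: the ground programs obtained from the terminals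
that are minimal with respect to inclusion. -/
def grounding (G : Grounder P) : Set (Set (GTGD L)) :=
  {Γ | ∃ S : Choices P, G.IsTerminal S ∧ (¬ ∃ S' : Choices P, G.IsTerminal S' ∧ S'.val ⊂ S.val) ∧
    Γ = G.program S}

/-- The possible outcomes: the members of the grounding all of whose sampled values have positive
probability. -/
def possibleOutcomes (G : Grounder P) : Set (Set (GTGD L)) :=
  {Γ | Γ ∈ G.grounding ∧ ∀ δ p q o, .result δ p q o ∈ heads Γ → 0 < L.dist δ p o}

end Grounder

/-- The factor that a head atom contributes to a probability: `δ⟨p⟩(o)` for `Result(p, q, o)`. -/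
noncomputable def weight : GAtom L → ℝ≥0∞
  | .result δ p _ o => L.dist δ p o
  | _ => 1

/-- The product of `δ⟨p⟩(o)` over all the atoms `Result(p, q, o)` among the heads. -/
noncomputable def pr (Γ : Set (GTGD L)) : ℝ≥0∞ := ∏ᶠ a ∈ heads Γ, weight a

/-! ### The declarative probability space -/

/-- The sample space of the declarative semantics. -/
@[ext]
structure Outcome (G : Grounder P) where
  val : Set (GTGD L)
  mem : val ∈ G.possibleOutcomes

/-- The set of finite possible outcomes. -/
def finOutcomes (G : Grounder P) : Set (Outcome G) := {ω | ω.val.Finite}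

/-- The set of infinite possible outcomes. -/
def infOutcomes (G : Grounder P) : Set (Outcome G) := {ω | ¬ ω.val.Finite}

/-- The events consisting of finite outcomes with the same stable models, maximal as such. -/
def outcomeClasses (G : Grounder P) : Set (Set (Outcome G)) :=
  {E | Maximal (fun F : Set (Outcome G) => F ⊆ finOutcomes G ∧
    ∀ ω ∈ F, ∀ ω' ∈ F, sms ω.val = sms ω'.val) E}

/-- The σ-algebra generated by those events and the event of all infinite outcomes. -/
instance outcomeAlgebra (G : Grounder P) : MeasurableSpace (Outcome G) :=
  MeasurableSpace.generateFrom (insert (infOutcomes G) (outcomeClasses G))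

/-- The measure of the declarative semantics: a finite outcome `Γ` has mass `pr Γ`, and the event
of the infinite outcomes gets the remaining mass. -/
noncomputable def outcomeMeasure (G : Grounder P) : Measure (Outcome G) :=
  completedMeasure (finOutcomes G) (fun ω => pr ω.val)

/-! ### The chase -/

/-- `Active(p, q)` is a trigger for `G(S)` on `S`. -/
def IsTrigger (G : Grounder P) (S : Choices P) (δ : L.Dist) (p : Fin (L.pdim δ) → C)
    (q : List C) : Prop :=
  .active δ p q ∈ heads (G.toFun S) ∧ ¬ DefinedAt S.val δ p q

/-- The sets that result from applying the trigger `Active(p, q)` to `S`: one for each value of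
positive probability. -/
def triggerResults (S : Choices P) (δ : L.Dist) (p : Fin (L.pdim δ) → C) (q : List C) :
    Set (Set (GTGD L)) :=
  {S' | ∃ o, 0 < L.dist δ p o ∧ S' = insert (atr δ p q o) S.val}

/-- A chase tree relative to `G` with set of nodes `N`: a rooted tree, possibly infinite, with
edges from nodes to their children, whose nodes are labelled by functionally consistent sets. The
root is labelled by the empty set; the children of a non-leaf node are in bijection, through their
labels, with the results of applying some trigger; and a leaf has no trigger. -/
structure ChaseTree (G : Grounder P) (N : Type*) where
  root : N
  child : N → N → Prop
  not_child_root : ∀ x, ¬ child x root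
  parent_unique : ∀ x y z, child x z → child y z → x = y
  reachable : ∀ x, Relation.ReflTransGen child root x
  label : N → Choices P
  label_root : (label root).val = ∅
  step : ∀ x, (∃ y, child x y) → ∃ δ p q, IsTrigger G (label x) δ p q ∧
    Set.BijOn (fun y => (label y).val) {y | child x y} (triggerResults (label x) δ p q)
  leaf : ∀ x, (¬ ∃ y, child x y) → ¬ ∃ δ p q, IsTrigger G (label x) δ p q

namespace ChaseTree

variable {G : Grounder P} {N : Type*}

/-- The maximal paths of finite length: from the root to a leaf. -/
structure FinPath (T : ChaseTree G N) where
  length : ℕ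
  node : Fin (length + 1) → N
  start : node 0 = T.root
  step : ∀ i : Fin length, T.child (node i.castSucc) (node i.succ)
  leaf : ¬ ∃ y, T.child (node (Fin.last length)) y

/-- The paths of infinite length that start at the root. -/
structure InfPath (T : ChaseTree G N) where
  node : ℕ → N
  start : node 0 = T.root
  step : ∀ i, T.child (node i) (node (i + 1))

/-- The sample space of the chase: all the maximal paths. -/
inductive MaxPath (T : ChaseTree G N) where
  | fin (π : T.FinPath)
  | inf (π : T.InfPath)

/-- The label of the leaf of a path of finite length. -/
def FinPath.choices {T : ChaseTree G N} (π : T.FinPath) : Choices P :=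
  T.label (π.node (Fin.last π.length))

/-- The ground program at the leaf of a path of finite length. -/
def FinPath.result {T : ChaseTree G N} (π : T.FinPath) : Set (GTGD L) := G.program π.choices

/-- The finite paths: those of finite length with a finite ground program at the leaf. -/
def finPaths (T : ChaseTree G N) : Set T.FinPath := {π | π.result.Finite}

/-- The event of all finite paths. -/
def finEvent (T : ChaseTree G N) : Set T.MaxPath := MaxPath.fin '' T.finPaths

/-- The event of all the other maximal paths. -/
def infEvent (T : ChaseTree G N) : Set T.MaxPath := T.finEventᶜ

/-- The events consisting of finite paths that lead to the same stable models, maximal as such. -/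
def pathClasses (T : ChaseTree G N) : Set (Set T.MaxPath) :=
  {E | Maximal (fun F : Set T.MaxPath => F ⊆ T.finEvent ∧
    ∀ π π' : T.FinPath, .fin π ∈ F → .fin π' ∈ F → sms π.result = sms π'.result) E}

/-- The σ-algebra generated by those events and the event of all the other paths. -/
instance pathAlgebra (T : ChaseTree G N) : MeasurableSpace T.MaxPath :=
  MeasurableSpace.generateFrom (insert T.infEvent T.pathClasses)

/-- The product of the probabilities of the values sampled along a path of finite length; it is
used for finite paths only. -/
noncomputable def MaxPath.pr {T : ChaseTree G N} : T.MaxPath → ℝ≥0∞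
  | .fin π => GDatalog.pr π.choices.val
  | .inf _ => 0

/-- The chase-based measure: a finite path has as its mass the product of the probabilities of the
values sampled along it, and the event of all the other paths gets the remaining mass. -/
noncomputable def pathMeasure (T : ChaseTree G N) : Measure T.MaxPath :=
  completedMeasure T.finEvent MaxPath.pr

/-- The set of outcomes that corresponds to a set of paths: a finite path stands for its ground
program, and the event of the non-finite paths for the event of the infinite outcomes. -/
def transfer (T : ChaseTree G N) (A : Set T.MaxPath) : Set (Outcome G) :=
  {ω | (∃ π ∈ T.finPaths, MaxPath.fin π ∈ A ∧ ω.val = π.result) ∨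
    (ω ∈ infOutcomes G ∧ (A ∩ T.infEvent).Nonempty)}

end ChaseTree

end Semantics

end GDatalog

/-!
The proof rests on one observation about choice sets. Call a choice set *forced* if its values have
positive probability and it is contained in every terminal consistent with it. Applying a trigger
with a value of positive probability keeps a set forced: by monotonicity of the grounder, a terminal
that contains the set must choose a value for the trigger, and consistency leaves only one
(`Grounder.Forced.insert`). Hence all labels of a chase tree are forced. A forced terminal is a
minimal one, so the leaves of the tree carry possible outcomes; conversely, a possible outcome tells
which child to move to at every node, and the path obtained ends at a leaf with that very outcome
unless both the path and the outcome are infinite (`exists_finPath_result_eq_or_infPath`). This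
gives the bijection `bijOn_result`.

Unions of chains of forced sets are forced as well. So, by Zorn's lemma, the choices made along an
infinite path extend to a forced set without triggers, that is, to an infinite possible outcome
(`Grounder.Forced.exists_outcome`). No continuity of the grounder and no fairness of the chase is
needed. It follows that there is an infinite outcome if and only if there is a maximal path that is
not finite (`infOutcomes_nonempty_iff`).

For the total masses, every inner node of the tree passes its mass on to its children, the values of
a distribution having total probability `1`. Summing over the levels of the tree shows that the
leaves have mass at most `1` (`tsum_mass_leaves_le`). If there were a deficit, some child of every
node with a deficit would have one too, which produces an infinite path
(`exists_child_tsum_leavesBelow_lt`). So the deficit, which both measures assign to the remaining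
event, vanishes when that event is empty, for paths and therefore also for outcomes.

Finally, finite paths have positive masses of sum at most `1`, so there are countably many of them,
and both σ-algebras consist of the sets that are saturated for the map to the set of stable models
(with a separate value for what is not finite). These maps have the same range, which yields the
isomorphism of σ-algebras (`saturatedOrderIso`).
-/

namespace GDatalog

/-! ### σ-algebras generated by countable partitions -/

section Partition

/-- If a key with countably many values distinguishes the cells of a partition, and the cell of key
`none` is the complement of `F`, then the σ-algebra generated by the cells consists of the sets that
are saturated for the key. The cells inside `F` are described as the maximal subsets of `F` on which
the key is constant; there is the additional such set `∅` if `F` is empty. -/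
theorem measurableSet_generateFrom_cells_iff {X K : Type*} {F : Set X} {key : X → Option K}
    (hF : ∀ x, x ∈ F ↔ key x ≠ none) (hc : (Set.range key).Countable) {A : Set X} :
    MeasurableSet[MeasurableSpace.generateFrom (insert Fᶜ {E | Maximal (fun E : Set X => E ⊆ F ∧
      ∀ x ∈ E, ∀ y ∈ E, key x = key y) E})] A ↔ ∀ x y, key x = key y → x ∈ A → y ∈ A := by
  constructor
  · intro hA
    induction A, hA using MeasurableSpace.generateFrom_induction with
    | hC E hE _ =>
      rintro x y hxy hx
      rcases hE with rfl | hE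
      · rw [Set.mem_compl_iff, hF] at hx ⊢
        rwa [← hxy]
      · refine hE.2 (y := insert y E) ⟨?_, ?_⟩ (Set.subset_insert _ _) (Set.mem_insert _ _)
        · refine Set.insert_subset ?_ hE.1.1
          rw [hF, ← hxy, ← hF]
          exact hE.1.1 hx
        · have hyE : ∀ z ∈ insert y E, key z = key x := by
            rintro z (rfl | hz)
            · exact hxy.symm
            · exact hE.1.2 z hz x hx
          intro z hz z' hz'
          rw [hyE z hz, hyE z' hz']
    | empty => simp
    | compl E _ ih => exact fun x y hxy hx hy => hx (ih y x hxy.symm hy)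
    | iUnion f _ ih =>
      intro x y hxy hx
      obtain ⟨i, hi⟩ := Set.mem_iUnion.1 hx
      exact Set.mem_iUnion.2 ⟨i, ih i x y hxy hi⟩
  · intro hA
    have hA' : A = ⋃ k ∈ key '' A, key ⁻¹' {k} := by
      ext y
      simp only [Set.mem_iUnion, Set.mem_preimage, Set.mem_singleton_iff, exists_prop]
      exact ⟨fun hy => ⟨_, ⟨y, hy, rfl⟩, rfl⟩, fun ⟨_, ⟨x, hx, hk⟩, hy⟩ =>
        hA x y (hk.trans hy.symm) hx⟩
    rw [hA']
    refine @MeasurableSet.biUnion _ _ (_) _ _ (hc.mono (Set.image_subset_range _ _)) fun k hk => ?_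
    apply MeasurableSpace.measurableSet_generateFrom
    obtain ⟨x, -, rfl⟩ := hk
    cases hx : key x with
    | none =>
      left
      ext y
      simp [hF]
    | some k =>
      refine .inr ⟨⟨fun y hy => ?_, ?_⟩, ?_⟩
      · rw [hF, show key y = some k from hy]
        simp
      · rintro y hy z hz
        exact Eq.trans hy (Eq.symm hz)
      · intro E hE hle y hy
        exact (hE.2 y hy x (hle hx)).trans hx

variable {X Y K : Type*} [MeasurableSpace X] [MeasurableSpace Y] {f : X → K} {g : Y → K}

/-- If the σ-algebras of `X` and `Y` consist of the saturated sets for keys with the same range,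
they are isomorphic. -/
def saturatedOrderIso (hf : ∀ A, MeasurableSet A ↔ ∀ x y, f x = f y → x ∈ A → y ∈ A)
    (hg : ∀ A, MeasurableSet A ↔ ∀ x y, g x = g y → x ∈ A → y ∈ A)
    (hfg : Set.range f = Set.range g) :
    {A : Set X // MeasurableSet A} ≃o {B : Set Y // MeasurableSet B} where
  toFun A := ⟨{y | ∃ x ∈ A.1, f x = g y}, (hg _).2 fun _ _ h ⟨x, hx, hxy⟩ => ⟨x, hx, hxy.trans h⟩⟩
  invFun B := ⟨{x | ∃ y ∈ B.1, g y = f x}, (hf _).2 fun _ _ h ⟨x, hx, hxy⟩ => ⟨x, hx, hxy.trans h⟩⟩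
  left_inv := by
    rintro ⟨A, hA⟩
    ext x
    constructor
    · rintro ⟨y, ⟨x', hx', h⟩, h'⟩
      exact (hf A).1 hA x' x (h.trans h') hx'
    · intro hx
      obtain ⟨y, hy⟩ := hfg ▸ Set.mem_range_self (f := f) x
      exact ⟨y, ⟨x, hx, hy.symm⟩, hy⟩
  right_inv := by
    rintro ⟨B, hB⟩
    ext y
    constructor
    · rintro ⟨x, ⟨y', hy', h⟩, h'⟩
      exact (hg B).1 hB y' y (h.trans h') hy'
    · intro hy
      obtain ⟨x, hx⟩ := hfg ▸ Set.mem_range_self (f := g) y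
      exact ⟨x, ⟨y, hy, hx.symm⟩, hx⟩
  map_rel_iff' := by
    rintro ⟨A, hA⟩ ⟨B, hB⟩
    constructor
    · intro h x hx
      obtain ⟨y, hy⟩ := hfg ▸ Set.mem_range_self (f := f) x
      obtain ⟨x', hx', h'⟩ := h (show y ∈ {y | ∃ x ∈ A, f x = g y} from ⟨x, hx, hy.symm⟩)
      exact (hf B).1 hB x' x (h'.trans hy) hx'
    · rintro h y ⟨x, hx, hxy⟩
      exact ⟨x, h hx, hxy⟩

end Partition

/-! ### Completed measures -/

section CompletedMeasure

variable {Ω : Type*} [MeasurableSpace Ω] {F : Set Ω} {m : Ω → ℝ≥0∞}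

open Classical in
theorem completedMeasure_apply {A : Set Ω} (hA : MeasurableSet A)
    (hatom : (A ∩ Fᶜ).Nonempty → Fᶜ ⊆ A) :
    completedMeasure F m A = ∑' ω : F, (if (ω : Ω) ∈ A then m ω else 0) +
      (if (A ∩ Fᶜ).Nonempty then 1 - ∑' ω : F, m ω else 0) := by
  rw [completedMeasure, Measure.add_apply, Measure.sum_apply _ hA]
  congr 1
  · refine tsum_congr fun ω => ?_
    rw [Measure.smul_apply, Measure.dirac_apply' _ hA]
    by_cases h : (ω : Ω) ∈ A <;> simp [h]
  · by_cases h : (A ∩ Fᶜ).Nonempty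
    · have hne : Fᶜ.Nonempty := h.mono Set.inter_subset_right
      rw [if_pos h, dif_pos hne, Measure.smul_apply, Measure.dirac_apply' _ hA,
        Set.indicator_of_mem (hatom h hne.some_mem)]
      simp
    · rw [if_neg h]
      split_ifs with hne
      · rw [Measure.smul_apply, Measure.dirac_apply' _ hA, Set.indicator_of_notMem]
        · simp
        · exact fun h' => h ⟨_, h', hne.some_mem⟩
      · simp

theorem isProbabilityMeasure_completedMeasure (hle : ∑' ω : F, m ω ≤ 1)
    (heq : ¬ Fᶜ.Nonempty → ∑' ω : F, m ω = 1) : IsProbabilityMeasure (completedMeasure F m) := by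
  constructor
  rw [completedMeasure_apply MeasurableSet.univ fun _ => Set.subset_univ _]
  simp only [Set.mem_univ, if_true, Set.univ_inter]
  split_ifs with h
  · exact add_tsub_cancel_of_le hle
  · rw [heq (by simpa using h), add_zero]

end CompletedMeasure

variable {C : Type u} {L : Vocabulary.{u, v, w} C} {P : Set (Rule L)} {G : Grounder P}

/-! ### Ground instances of the translated program -/

theorem Term.eval_rename_inl (h : XVar → C) (k : ℕ → C) (t : Term C ℕ) :
    (t.rename Sum.inl).eval (Sum.elim (fun x => h (.inl x)) k) = (t.rename Sum.inl).eval h := by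
  cases t <;> rfl

theorem Term.eval_var {X : Type} (h : X → C) (x : X) : (Term.var x : Term C X).eval h = h x := rfl

theorem atr_right_injective (δ : L.Dist) (p : Fin (L.pdim δ) → C) (q : List C) :
    Function.Injective (atr δ p q) := fun o o' h => by
  have := congrArg TGD.head h
  simpa [atr] using this

theorem eq_atr_of_mem_ground_exTGDs {τ : GTGD L} (h : τ ∈ ground (exTGDs P)) :
    ∃ δ p q o, τ = atr δ p q o := by
  obtain ⟨_, ⟨ρ, -, i, d, -, rfl⟩, h, rfl⟩ := h
  exact ⟨d.dist, _, _, _, TGD.ext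
    (by simp [TGD.map, Rule.atrTGD, atr, DTerm.active, XAtom.map])
    (by simp [TGD.map, Rule.atrTGD, atr])
    rfl⟩

theorem result_notMem_heads_ground_nexTGDs (δ : L.Dist) (p : Fin (L.pdim δ) → C) (q : List C)
    (o : C) : .result δ p q o ∉ heads (ground (nexTGDs P)) := by
  rintro ⟨_, ⟨_, ⟨ρ, -, rfl | ⟨i, d, -, rfl⟩⟩, h, rfl⟩, hh⟩ <;>
  simp [TGD.map, Rule.mainTGD, Rule.activeTGD, DTerm.active, XAtom.map] at hh

/-- The outcome variable of an active-to-result TGD does not occur in its body, so an `Active` atom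
that can be derived has an active-to-result instance for every value. -/
theorem atr_mem_ground_exTGDs {δ : L.Dist} {p : Fin (L.pdim δ) → C} {q : List C}
    (h : .active δ p q ∈ heads (ground (nexTGDs P))) (o : C) :
    atr δ p q o ∈ ground (exTGDs P) := by
  obtain ⟨_, ⟨_, ⟨ρ, hρ, rfl | ⟨i, d, hd, rfl⟩⟩, h, rfl⟩, hh⟩ := h
  · simp [TGD.map, Rule.mainTGD, XAtom.map] at hh
  · refine ⟨_, ⟨ρ, hρ, i, d, hd, rfl⟩, Sum.elim (fun x => h (.inl x)) (fun _ => o), ?_⟩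
    simp only [TGD.map, Rule.activeTGD, DTerm.active, XAtom.map, XAtom.active.injEq] at hh
    obtain ⟨rfl, hp, hq⟩ := hh
    obtain rfl := eq_of_heq hp
    subst hq
    ext1
    · simp [atr, TGD.map, Rule.atrTGD, DTerm.active, XAtom.map, Term.eval_rename_inl]
    · simp [atr, TGD.map, Rule.atrTGD]
    · simp [atr, TGD.map, Rule.atrTGD, DTerm.result, XAtom.map, Term.eval_rename_inl,
        Term.eval_var]

theorem heads_mono {S S' : Set (GTGD L)} (h : S ⊆ S') : heads S ⊆ heads S' := Set.image_mono h

namespace Choices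

theorem result_mem_heads_iff (S : Choices P) {δ : L.Dist} {p : Fin (L.pdim δ) → C} {q : List C}
    {o : C} : .result δ p q o ∈ heads S.val ↔ atr δ p q o ∈ S.val := by
  refine ⟨?_, fun h => ⟨_, h, rfl⟩⟩
  rintro ⟨τ, hτ, h⟩
  obtain ⟨δ', p', q', o', rfl⟩ := eq_atr_of_mem_ground_exTGDs (S.subset_ground hτ)
  simp only [atr, XAtom.result.injEq] at h
  obtain ⟨rfl, hp, rfl, rfl⟩ := h
  obtain rfl := eq_of_heq hp
  exact hτ

theorem val_subset_iff {S : Choices P} {V : Set (GTGD L)} :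
    S.val ⊆ V ↔ ∀ δ p q o, atr δ p q o ∈ S.val → atr δ p q o ∈ V := by
  refine ⟨fun h _ _ _ _ h' => h h', fun h τ hτ => ?_⟩
  obtain ⟨δ, p, q, o, rfl⟩ := eq_atr_of_mem_ground_exTGDs (S.subset_ground hτ)
  exact h _ _ _ _ hτ

/-- Two choice sets are consistent if they agree on the `Active` atoms on which both are defined. -/
def Consistent (S S' : Choices P) : Prop :=
  ∀ δ p q o o', atr δ p q o ∈ S.val → atr δ p q o' ∈ S'.val → o = o'

end Choices

/-- Applying a trigger keeps a choice set functional, whatever the value. -/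
theorem IsTrigger.exists_insert {S : Choices P} {δ : L.Dist}
    {p : Fin (L.pdim δ) → C} {q : List C} (h : IsTrigger G S δ p q) (o : C) :
    ∃ S' : Choices P, S'.val = insert (atr δ p q o) S.val := by
  refine ⟨⟨_, Set.insert_subset (atr_mem_ground_exTGDs (heads_mono (G.subset_ground S) h.1) o)
    S.subset_ground, ?_⟩, rfl⟩
  intro δ' p' q' o₁ o₂ h₁ h₂
  by_cases hd : DefinedAt S.val δ' p' q'
  · -- the new TGD is not about an atom on which `S` is defined
    have key : ∀ o', atr δ' p' q' o' ∈ insert (atr δ p q o) S.val → atr δ' p' q' o' ∈ S.val := by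
      rintro o' (h' | h')
      · have := congrArg TGD.head h'
        simp only [atr, XAtom.result.injEq] at this
        obtain ⟨rfl, hp, rfl, -⟩ := this
        obtain rfl := eq_of_heq hp
        exact absurd hd h.2
      · exact h'
    exact S.functional _ _ _ _ _ (key _ h₁) (key _ h₂)
  · have key : ∀ o', atr δ' p' q' o' ∈ insert (atr δ p q o) S.val → o' = o := by
      rintro o' (h' | h')
      · have := congrArg TGD.head h'
        simp only [atr, XAtom.result.injEq] at this
        exact this.2.2.2
      · exact absurd ⟨_, h'⟩ hd
    rw [key _ h₁, key _ h₂]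

namespace Grounder

theorem result_mem_heads_program_iff (G : Grounder P) (S : Choices P) {δ : L.Dist}
    {p : Fin (L.pdim δ) → C} {q : List C} {o : C} :
    .result δ p q o ∈ heads (G.program S) ↔ atr δ p q o ∈ S.val := by
  rw [program, heads, Set.image_union, Set.mem_union]
  refine ⟨?_, fun h => .inl (S.result_mem_heads_iff.2 h)⟩
  rintro (h | h)
  · exact S.result_mem_heads_iff.1 h
  · exact absurd (heads_mono (G.subset_ground S) h) (result_notMem_heads_ground_nexTGDs _ _ _ _)

theorem program_injective (G : Grounder P) : Function.Injective G.program := by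
  intro S S' h
  apply Choices.ext
  apply Set.Subset.antisymm <;>
  · refine Choices.val_subset_iff.2 fun δ p q o ho => ?_
    rw [← G.result_mem_heads_program_iff] at ho ⊢
    simpa [h] using ho

/-- The heads that contribute to the probability of an outcome come from its choice set. -/
theorem pr_program (G : Grounder P) (S : Choices P) : pr (G.program S) = pr S.val := by
  refine finprod_mem_inter_mulSupport_eq' _ _ _ fun a ha => ?_
  cases a with
  | result δ p q o => rw [result_mem_heads_program_iff, S.result_mem_heads_iff]
  | _ => exact absurd rfl ha

theorem not_isTrigger_iff {S : Choices P} :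
    (¬ ∃ δ p q, IsTrigger G S δ p q) ↔ G.IsTerminal S := by
  simp only [IsTrigger, IsTerminal, Compatible]
  push Not
  rfl

/-! ### Forced choice sets -/

/-- A choice set is forced if its values have positive probability and it is contained in every
terminal that is consistent with it. The labels of a chase tree are forced, and so are the unions of
chains of forced sets: forced sets are what a chase of transfinite length can reach. -/
def Forced (G : Grounder P) (S : Choices P) : Prop :=
  (∀ δ p q o, atr δ p q o ∈ S.val → 0 < L.dist δ p o) ∧
    ∀ S', G.IsTerminal S' → S.Consistent S' → S.val ⊆ S'.val

theorem forced_of_val_eq_empty {S : Choices P} (h : S.val = ∅) : G.Forced S := by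
  simp [Forced, h]

theorem Forced.insert {S S' : Choices P} (hS : G.Forced S) {δ : L.Dist}
    {p : Fin (L.pdim δ) → C} {q : List C} {o : C} (h : IsTrigger G S δ p q)
    (ho : 0 < L.dist δ p o) (hS' : S'.val = insert (atr δ p q o) S.val) : G.Forced S' := by
  constructor
  · intro δ' p' q' o' h'
    rw [hS'] at h'
    rcases h' with h' | h'
    · have := congrArg TGD.head h'
      simp only [atr, XAtom.result.injEq] at this
      obtain ⟨rfl, hp, -, rfl⟩ := this
      obtain rfl := eq_of_heq hp
      exact ho
    · exact hS.1 _ _ _ _ h'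
  · intro U hU hc
    have hSU : S.val ⊆ U.val := hS.2 U hU fun δ p q o o' h₁ h₂ =>
      hc δ p q o o' (hS' ▸ Set.mem_insert_of_mem _ h₁) h₂
    obtain ⟨o', ho'⟩ := hU δ p q (heads_mono (G.monotone S U hSU) h.1)
    obtain rfl := hc δ p q o o' (hS' ▸ Set.mem_insert _ _) ho'
    rw [hS']
    exact Set.insert_subset ho' hSU

theorem exists_forced_sUnion {c : Set (Set (GTGD L))}
    (hc : ∀ V ∈ c, ∃ S, G.Forced S ∧ S.val = V) (hchain : IsChain (· ⊆ ·) c) :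
    ∃ S, G.Forced S ∧ S.val = ⋃₀ c := by
  refine ⟨⟨⋃₀ c, ?_, ?_⟩, ⟨?_, ?_⟩, rfl⟩
  · refine Set.sUnion_subset fun V hV => ?_
    obtain ⟨S, -, rfl⟩ := hc V hV
    exact S.subset_ground
  · rintro δ p q o o' ⟨V, hV, h⟩ ⟨V', hV', h'⟩
    obtain ⟨W, hW, hVW, hVW'⟩ := hchain.directedOn V hV V' hV'
    obtain ⟨S, -, rfl⟩ := hc W hW
    exact S.functional _ _ _ _ _ (hVW h) (hVW' h')
  · rintro δ p q o ⟨V, hV, h⟩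
    obtain ⟨S, hS, rfl⟩ := hc V hV
    exact hS.1 _ _ _ _ h
  · intro U hU hcons
    refine Set.sUnion_subset fun V hV => ?_
    obtain ⟨S, hS, rfl⟩ := hc V hV
    exact hS.2 U hU fun δ p q o o' h₁ h₂ => hcons δ p q o o' ⟨_, hV, h₁⟩ h₂

theorem Forced.program_mem_possibleOutcomes {S : Choices P} (hS : G.Forced S)
    (ht : G.IsTerminal S) : G.program S ∈ G.possibleOutcomes := by
  refine ⟨⟨S, ht, ?_, rfl⟩, fun δ p q o h => hS.1 _ _ q _ ((G.result_mem_heads_program_iff S).1 h)⟩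
  rintro ⟨S', ht', hlt⟩
  refine hlt.2 (hS.2 S' ht' fun δ p q o o' h h' => ?_)
  exact S.functional _ _ _ _ _ h (hlt.1 h')

/-- Every forced choice set extends to a possible outcome: a maximal forced set has no trigger,
since a trigger could be applied with a value of positive probability. -/
theorem Forced.exists_outcome {S : Choices P} (hS : G.Forced S) :
    ∃ S' : Choices P, S.val ⊆ S'.val ∧ G.program S' ∈ G.possibleOutcomes := by
  obtain ⟨_, hSM, ⟨M, hM, rfl⟩, hmax⟩ := zorn_subset_nonempty {V | ∃ S, G.Forced S ∧ S.val = V}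
    (fun c hc hchain _ => ⟨⋃₀ c, exists_forced_sUnion hc hchain,
      fun V hV => Set.subset_sUnion_of_mem hV⟩) S.val ⟨S, hS, rfl⟩
  refine ⟨M, hSM, hM.program_mem_possibleOutcomes (not_isTrigger_iff.1 ?_)⟩
  rintro ⟨δ, p, q, htr⟩
  obtain ⟨o, ho⟩ := (L.dist δ p).support_nonempty
  obtain ⟨M', hM'⟩ := htr.exists_insert o
  have hF : G.Forced M' := hM.insert htr ((L.dist δ p).apply_pos_iff o |>.2 ho) hM'
  have hle : M.val ≤ M'.val := hM' ▸ Set.subset_insert _ _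
  exact htr.2 ⟨o, hmax ⟨M', hF, rfl⟩ hle (hM' ▸ Set.mem_insert _ _)⟩

end Grounder

namespace ChaseTree

variable {N : Type*} (T : ChaseTree G N)

/-! ### Nodes and paths of a chase tree -/

/-- The leaves of a chase tree. -/
def leaves : Set N := {x | ¬ ∃ y, T.child x y}

variable {T}

theorem exists_label_eq_insert {x y : N} (h : T.child x y) :
    ∃ δ p q o, IsTrigger G (T.label x) δ p q ∧ 0 < L.dist δ p o ∧
      (T.label y).val = insert (atr δ p q o) (T.label x).val := by
  obtain ⟨δ, p, q, htr, hbij⟩ := T.step x ⟨y, h⟩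
  obtain ⟨o, ho, heq⟩ := hbij.mapsTo h
  exact ⟨δ, p, q, o, htr, ho, heq⟩

theorem label_ssubset {x y : N} (h : T.child x y) : (T.label x).val ⊂ (T.label y).val := by
  obtain ⟨δ, p, q, o, htr, -, heq⟩ := exists_label_eq_insert h
  rw [heq]
  exact Set.ssubset_insert fun ho => htr.2 ⟨o, ho⟩

theorem label_subset {x y : N} (h : Relation.ReflTransGen T.child x y) :
    (T.label x).val ⊆ (T.label y).val := by
  induction h with
  | refl => exact subset_rfl
  | tail _ h ih => exact ih.trans (label_ssubset h).subset

variable (T) in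
theorem finite_label (x : N) : (T.label x).val.Finite := by
  induction T.reachable x with
  | refl => simp [T.label_root]
  | tail _ h ih =>
    obtain ⟨δ, p, q, o, -, -, heq⟩ := exists_label_eq_insert h
    exact heq ▸ ih.insert _

variable (T) in
theorem forced_label (x : N) : G.Forced (T.label x) := by
  induction T.reachable x with
  | refl => exact Grounder.forced_of_val_eq_empty T.label_root
  | tail _ h ih =>
    obtain ⟨δ, p, q, o, htr, ho, heq⟩ := exists_label_eq_insert h
    exact ih.insert htr ho heq

theorem isTerminal_label_of_mem_leaves {x : N} (h : x ∈ T.leaves) : G.IsTerminal (T.label x) :=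
  Grounder.not_isTrigger_iff.1 (T.leaf x h)

/-- A terminal that contains the label of a node selects one of its children. -/
theorem exists_child_label_subset {x : N} {S : Choices P} (hx : x ∉ T.leaves)
    (hS : (T.label x).val ⊆ S.val) (ht : G.IsTerminal S)
    (hpos : ∀ δ p q o, atr δ p q o ∈ S.val → 0 < L.dist δ p o) :
    ∃ y, T.child x y ∧ (T.label y).val ⊆ S.val := by
  obtain ⟨δ, p, q, htr, hbij⟩ := T.step x (not_not.1 hx)
  obtain ⟨o, ho⟩ := ht δ p q (heads_mono (G.monotone _ _ hS) htr.1)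
  obtain ⟨y, hy, heq⟩ := hbij.surjOn ⟨o, hpos _ _ _ _ ho, rfl⟩
  exact ⟨y, hy, heq.trans_subset (Set.insert_subset ho hS)⟩

theorem child_unique_of_label_subset {x y y' : N} {S : Choices P} (h : T.child x y)
    (h' : T.child x y') (hS : (T.label y).val ⊆ S.val) (hS' : (T.label y').val ⊆ S.val) :
    y = y' := by
  obtain ⟨δ, p, q, htr, hbij⟩ := T.step x ⟨y, h⟩
  obtain ⟨o, ho, heq⟩ := hbij.mapsTo h
  obtain ⟨o', ho', heq'⟩ := hbij.mapsTo h'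
  refine hbij.injOn h h' ?_
  dsimp only at heq heq' ⊢
  obtain rfl : o = o' := S.functional δ p q o o' (hS (heq ▸ Set.mem_insert _ _))
    (hS' (heq' ▸ Set.mem_insert _ _))
  rw [heq, heq']

theorem exists_finPath {x : N} (hx : x ∈ T.leaves) :
    ∃ π : T.FinPath, π.node (Fin.last π.length) = x := by
  have key : ∀ x, Relation.ReflTransGen T.child T.root x → ∃ (n : ℕ) (f : ℕ → N),
      f 0 = T.root ∧ f n = x ∧ ∀ i < n, T.child (f i) (f (i + 1)) := by
    intro x h
    induction h with
    | refl => exact ⟨0, fun _ => T.root, rfl, rfl, by simp⟩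
    | @tail y z _ h ih =>
      obtain ⟨n, f, h0, hn, hf⟩ := ih
      refine ⟨n + 1, fun i => if i ≤ n then f i else z, by simp [h0], by simp, fun i hi => ?_⟩
      rcases Nat.lt_succ_iff_lt_or_eq.1 hi with hi | rfl
      · simpa [hi.le, Nat.succ_le_of_lt hi] using hf i hi
      · simpa [hn] using h
  obtain ⟨n, f, h0, rfl, hf⟩ := key x (T.reachable x)
  exact ⟨⟨n, fun i => f i, h0, fun i => hf i i.2, hx⟩, rfl⟩

/-- A property of the root that every non-leaf hands down to some child is shared by some leaf or by
all the nodes of an infinite path. -/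
theorem exists_finPath_or_infPath (p : N → Prop) (h0 : p T.root)
    (h : ∀ x ∉ T.leaves, p x → ∃ y, T.child x y ∧ p y) :
    (∃ π : T.FinPath, p (π.node (Fin.last π.length))) ∨ ∃ π : T.InfPath, ∀ i, p (π.node i) := by
  by_cases hl : ∃ x ∈ T.leaves, p x
  · obtain ⟨x, hx, hp⟩ := hl
    obtain ⟨π, rfl⟩ := exists_finPath hx
    exact .inl ⟨π, hp⟩
  · push Not at hl
    choose! s hs hp using fun x (hx : p x) => h x (fun hl' => hl x hl' hx) hx
    have hall : ∀ i, p (s^[i] T.root) := fun i => by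
      induction i with
      | zero => exact h0
      | succ i ih => rw [Function.iterate_succ_apply']; exact hp _ ih
    exact .inr ⟨⟨fun i => s^[i] T.root, rfl, fun i => by
      rw [Function.iterate_succ_apply']; exact hs _ (hall i)⟩, hall⟩

theorem FinPath.node_eq_of_label_subset {π π' : T.FinPath} {S : Choices P}
    (h : π.choices.val ⊆ S.val) (h' : π'.choices.val ⊆ S.val) (i : ℕ) (hi : i < π.length + 1)
    (hi' : i < π'.length + 1) : π.node ⟨i, hi⟩ = π'.node ⟨i, hi'⟩ := by
  have hle : ∀ (π : T.FinPath) (j : Fin (π.length + 1)),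
      (T.label (π.node j)).val ⊆ π.choices.val := by
    intro π j
    induction j using Fin.reverseInduction with
    | last => exact subset_rfl
    | cast j ih => exact (label_ssubset (π.step j)).subset.trans ih
  induction i with
  | zero => exact π.start.trans π'.start.symm
  | succ i ih =>
    have hs := π.step ⟨i, Nat.lt_of_succ_lt_succ hi⟩
    have hs' := π'.step ⟨i, Nat.lt_of_succ_lt_succ hi'⟩
    rw [Fin.castSucc_mk, ih (Nat.lt_of_succ_lt hi) (Nat.lt_of_succ_lt hi')] at hs
    exact child_unique_of_label_subset hs hs' ((hle π _).trans h) ((hle π' _).trans h')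

theorem FinPath.length_le_of_label_subset {π π' : T.FinPath} {S : Choices P}
    (h : π.choices.val ⊆ S.val) (h' : π'.choices.val ⊆ S.val) : π.length ≤ π'.length := by
  by_contra! hlt
  have hs := π.step ⟨π'.length, hlt⟩
  rw [Fin.castSucc_mk, node_eq_of_label_subset h h' π'.length (by omega) (by omega)] at hs
  exact π'.leaf ⟨_, hs⟩

/-- A path is determined by the label of its leaf, since this label tells which child the path moves
to at every node. -/
theorem FinPath.choices_injective : Function.Injective (FinPath.choices (T := T)) := by
  intro π π' h
  have h₁ : π.choices.val ⊆ π'.choices.val := h ▸ subset_rfl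
  have hlen := le_antisymm (length_le_of_label_subset h₁ subset_rfl)
    (length_le_of_label_subset subset_rfl h₁)
  have hnode := node_eq_of_label_subset h₁ subset_rfl
  obtain ⟨n, f, _, _, _⟩ := π
  obtain ⟨n', f', _, _, _⟩ := π'
  obtain rfl : n = n' := hlen
  obtain rfl : f = f' := funext fun i => hnode i i.2 i.2
  rfl

theorem FinPath.result_injective : Function.Injective (FinPath.result (T := T)) :=
  G.program_injective.comp choices_injective

theorem FinPath.result_mem_possibleOutcomes (π : T.FinPath) : π.result ∈ G.possibleOutcomes :=
  (T.forced_label _).program_mem_possibleOutcomes (isTerminal_label_of_mem_leaves π.leaf)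

variable (T) in
/-- The path that follows the choices of a possible outcome either ends at a leaf with this outcome,
or it is infinite, and so is the outcome. -/
theorem exists_finPath_result_eq_or_infPath {Γ : Set (GTGD L)} (hΓ : Γ ∈ G.possibleOutcomes) :
    (∃ π : T.FinPath, π.result = Γ) ∨ (¬ Γ.Finite ∧ Nonempty T.InfPath) := by
  obtain ⟨⟨S, ht, hmin, rfl⟩, hpos⟩ := hΓ
  have hpos' : ∀ δ p q o, atr δ p q o ∈ S.val → 0 < L.dist δ p o := fun δ p q o h =>
    hpos δ p q o ((G.result_mem_heads_program_iff S).2 h)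
  rcases exists_finPath_or_infPath (T := T) (fun x => (T.label x).val ⊆ S.val)
    (by simp [T.label_root])
    (fun x hx hS => exists_child_label_subset hx hS ht hpos') with ⟨π, hπ⟩ | ⟨π, hπ⟩
  · left
    refine ⟨π, congrArg G.program (Choices.ext (hπ.antisymm ?_))⟩
    by_contra hn
    exact hmin ⟨_, isTerminal_label_of_mem_leaves π.leaf, hπ, hn⟩
  · refine .inr ⟨fun hfin => ?_, ⟨π⟩⟩
    have hS : S.val.Finite := hfin.subset Set.subset_union_left
    -- the labels along the path would be infinitely many subsets of a finite set
    have hmono : StrictMono fun i => (T.label (π.node i)).val :=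
      strictMono_nat_of_lt_succ fun i => label_ssubset (π.step i)
    exact Set.infinite_range_of_injective hmono.injective
      (hS.finite_subsets.subset (Set.range_subset_iff.2 hπ))

variable (T) in
theorem bijOn_result :
    Set.BijOn FinPath.result T.finPaths {Γ | Γ ∈ G.possibleOutcomes ∧ Γ.Finite} := by
  refine ⟨fun π hπ => ⟨π.result_mem_possibleOutcomes, hπ⟩, FinPath.result_injective.injOn, ?_⟩
  rintro Γ ⟨hΓ, hfin⟩
  rcases T.exists_finPath_result_eq_or_infPath hΓ with ⟨π, rfl⟩ | ⟨h, -⟩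
  · exact ⟨π, hfin, rfl⟩
  · exact absurd hfin h

/-- The choices made along an infinite path form a forced set, which extends to an outcome. -/
theorem InfPath.exists_infinite_outcome (π : T.InfPath) :
    ∃ Γ ∈ G.possibleOutcomes, ¬ Γ.Finite := by
  have hmono : StrictMono fun i => (T.label (π.node i)).val :=
    strictMono_nat_of_lt_succ fun i => label_ssubset (π.step i)
  obtain ⟨S, hS, hSc⟩ := Grounder.exists_forced_sUnion (G := G)
    (c := Set.range fun i => (T.label (π.node i)).val)
    (by rintro _ ⟨i, rfl⟩; exact ⟨_, T.forced_label _, rfl⟩) hmono.monotone.isChain_range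
  obtain ⟨S', hSS', hS'⟩ := hS.exists_outcome
  refine ⟨_, hS', fun hfin => ?_⟩
  have hS'fin : S'.val.Finite := hfin.subset Set.subset_union_left
  refine Set.infinite_range_of_injective hmono.injective
    (hS'fin.finite_subsets.subset (Set.range_subset_iff.2 fun i => ?_))
  exact (Set.subset_sUnion_of_mem (Set.mem_range_self i)).trans (hSc ▸ hSS')

variable (T) in
theorem infOutcomes_nonempty_iff : (infOutcomes G).Nonempty ↔ T.infEvent.Nonempty := by
  constructor
  · rintro ⟨ω, hω⟩
    rcases T.exists_finPath_result_eq_or_infPath ω.mem with ⟨π, hπ⟩ | ⟨-, ⟨π⟩⟩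
    · refine ⟨.fin π, ?_⟩
      rintro ⟨π', hπ', h⟩
      obtain rfl := MaxPath.fin.inj h
      exact hω (hπ ▸ hπ')
    · refine ⟨.inf π, ?_⟩
      rintro ⟨π', -, h⟩
      cases h
  · rintro ⟨π | π, hπ⟩
    · exact ⟨⟨_, π.result_mem_possibleOutcomes⟩, fun h => hπ ⟨π, h, rfl⟩⟩
    · obtain ⟨Γ, hΓ, h⟩ := π.exists_infinite_outcome
      exact ⟨⟨Γ, hΓ⟩, h⟩

theorem finPaths_eq_univ (h : ∀ S, S.val.Finite → (G.toFun S).Finite) : T.finPaths = Set.univ :=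
  Set.eq_univ_of_forall fun _ => (T.finite_label _).union (h _ (T.finite_label _))

end ChaseTree

/-! ### Probability mass in a chase tree -/

theorem Choices.pr_pos {S : Choices P}
    (h : ∀ δ p q o, atr δ p q o ∈ S.val → 0 < L.dist δ p o) : 0 < pr S.val := by
  refine finprod_mem_induction (0 < ·) one_pos (fun _ _ h h' => ENNReal.mul_pos h.ne' h'.ne') ?_
  intro a ha
  cases a with
  | result δ p q o => exact h δ p q o (S.result_mem_heads_iff.1 ha)
  | _ => exact one_pos

theorem Choices.pr_insert {S : Choices P} (hS : S.val.Finite) {δ : L.Dist}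
    {p : Fin (L.pdim δ) → C} {q : List C} (h : ¬ DefinedAt S.val δ p q) (o : C) :
    pr (insert (atr δ p q o) S.val) = L.dist δ p o * pr S.val := by
  rw [pr, heads, Set.image_insert_eq, finprod_mem_insert _ _ (hS.image _)]
  · rfl
  · exact fun ho => h ⟨o, S.result_mem_heads_iff.1 ho⟩

namespace ChaseTree

variable {N : Type*} {T : ChaseTree G N}

variable (T) in
/-- The probability of making the choices that lead to a node. -/
noncomputable def mass (x : N) : ℝ≥0∞ := pr (T.label x).val

variable (T) in
theorem mass_root : T.mass T.root = 1 := by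
  simp [mass, T.label_root, pr, heads]

variable (T) in
theorem mass_pos (x : N) : 0 < T.mass x := Choices.pr_pos (T.forced_label x).1

/-- The mass of an inner node is distributed among its children. -/
theorem tsum_mass_children {x : N} (hx : x ∉ T.leaves) :
    ∑' y : {y | T.child x y}, T.mass y = T.mass x := by
  obtain ⟨δ, p, q, htr, hbij⟩ := T.step x (not_not.1 hx)
  have himg : triggerResults (T.label x) δ p q =
      (fun o => insert (atr δ p q o) (T.label x).val) '' (L.dist δ p).support := by
    ext V
    simp only [triggerResults, Set.mem_ofPred_eq, Set.mem_image, ← PMF.apply_pos_iff, eq_comm]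
  have hinj : Set.InjOn (fun o => insert (atr δ p q o) (T.label x).val)
      (L.dist δ p).support := by
    intro o _ o' _ h
    have : atr δ p q o ∈ insert (atr δ p q o') (T.label x).val := by
      have h' : insert (atr δ p q o) (T.label x).val = insert (atr δ p q o') (T.label x).val := h
      exact h' ▸ Set.mem_insert _ _
    rcases this with h | h
    · exact atr_right_injective δ p q h
    · exact absurd ⟨o, h⟩ htr.2
  calc ∑' y : {y | T.child x y}, T.mass y
      = ∑' V : triggerResults (T.label x) δ p q, pr V.1 := hbij.equiv.tsum_eq (fun V => pr V.1)
    _ = ∑' o : (L.dist δ p).support, L.dist δ p o * T.mass x := by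
        rw [himg, tsum_image pr hinj]
        exact tsum_congr fun o => Choices.pr_insert (T.finite_label x) htr.2 o
    _ = T.mass x := by
        rw [ENNReal.tsum_mul_right, PMF.support,
          tsum_subtype_eq_of_support_subset (f := L.dist δ p) subset_rfl, PMF.tsum_coe, one_mul]

variable (T) in
/-- The nodes of depth `n`. -/
def level : ℕ → Set N
  | 0 => {T.root}
  | n + 1 => ⋃ x ∈ level n \ T.leaves, {y | T.child x y}

variable (T) in
theorem tsum_mass_level_succ (n : ℕ) :
    ∑' x : ↑(T.level n ∩ T.leaves), T.mass x + ∑' x : T.level (n + 1), T.mass x ≤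
      ∑' x : T.level n, T.mass x := by
  calc _ ≤ ∑' x : ↑(T.level n ∩ T.leaves), T.mass x +
        ∑' x : ↑(T.level n \ T.leaves), T.mass x := by
        refine add_le_add_right ((ENNReal.tsum_biUnion_le_tsum _ _ _).trans_eq ?_) _
        exact tsum_congr fun x => tsum_mass_children x.2.2
    _ = ∑' x : T.level n, T.mass x := by
        rw [← ENNReal.summable.tsum_union_disjoint (Set.disjoint_sdiff_right.mono_left
          Set.inter_subset_right) ENNReal.summable, Set.inter_union_sdiff]

variable (T) in
theorem sum_mass_leaves_add_level (n : ℕ) :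
    ∑ i ∈ Finset.range n, ∑' x : ↑(T.level i ∩ T.leaves), T.mass x +
      ∑' x : T.level n, T.mass x ≤ 1 := by
  induction n with
  | zero =>
    rw [level, tsum_singleton T.root T.mass, mass_root]
    simp
  | succ n ih =>
    rw [Finset.sum_range_succ, add_assoc]
    exact (add_le_add_right (T.tsum_mass_level_succ n) _).trans ih

variable (T) in
theorem tsum_mass_leaves_le : ∑' x : T.leaves, T.mass x ≤ 1 := by
  have hcover : T.leaves ⊆ ⋃ n, (T.level n ∩ T.leaves) := by
    intro x hx
    suffices ∃ n, x ∈ T.level n by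
      obtain ⟨n, hn⟩ := this
      exact Set.mem_iUnion.2 ⟨n, hn, hx⟩
    clear hx
    induction T.reachable x with
    | refl => exact ⟨0, rfl⟩
    | @tail y z _ h ih =>
      obtain ⟨n, hn⟩ := ih
      exact ⟨n + 1, Set.mem_biUnion ⟨hn, fun hl => hl ⟨z, h⟩⟩ h⟩
  calc ∑' x : T.leaves, T.mass x
      ≤ ∑' x : ↑(⋃ n, (T.level n ∩ T.leaves)), T.mass x := ENNReal.tsum_mono_subtype _ hcover
    _ ≤ ∑' n, ∑' x : ↑(T.level n ∩ T.leaves), T.mass x := ENNReal.tsum_iUnion_le_tsum _ _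
    _ ≤ 1 := ENNReal.tsum_le_of_sum_range_le fun n =>
        le_self_add.trans (T.sum_mass_leaves_add_level n)

variable (T) in
/-- The leaves that are reached from a node. -/
def leavesBelow (x : N) : Set N := {l ∈ T.leaves | Relation.ReflTransGen T.child x l}

variable (T) in
theorem pairwiseDisjoint_leavesBelow (x : N) :
    {y | T.child x y}.PairwiseDisjoint T.leavesBelow := by
  have key : ∀ y z, T.child x y → T.child x z → Relation.ReflTransGen T.child y z → y = z := by
    intro y z hy hz h
    rcases h.cases_tail with h | ⟨w, hw, hwz⟩
    · exact h.symm
    · -- the parent of `z` is `x`, so `x` would be a proper descendant of itself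
      obtain rfl := T.parent_unique _ _ _ hwz hz
      exact absurd (label_subset hw) (label_ssubset hy).2
  intro y hy z hz hne
  refine Set.disjoint_left.2 fun l hl hl' => hne ?_
  rcases Relation.ReflTransGen.total_of_right_unique
    (r := Function.swap T.child) (fun a b c h h' => T.parent_unique b c a h h')
    (Relation.reflTransGen_swap.2 hl.2) (Relation.reflTransGen_swap.2 hl'.2) with h | h
  · exact (key z y hz hy (Relation.reflTransGen_swap.1 h)).symm
  · exact key y z hy hz (Relation.reflTransGen_swap.1 h)

/-- If the mass of an inner node exceeds that of the leaves below it, the same holds for one of its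
children. So mass is only lost along infinite paths. -/
theorem exists_child_tsum_leavesBelow_lt {x : N} (hx : x ∉ T.leaves)
    (h : ∑' l : T.leavesBelow x, T.mass l < T.mass x) :
    ∃ y, T.child x y ∧ ∑' l : T.leavesBelow y, T.mass l < T.mass y := by
  by_contra! hn
  refine h.not_ge ?_
  calc T.mass x = ∑' y : {y | T.child x y}, T.mass y := (tsum_mass_children hx).symm
    _ ≤ ∑' y : {y | T.child x y}, ∑' l : T.leavesBelow y, T.mass l :=
        ENNReal.tsum_le_tsum fun y => hn y y.2
    _ = ∑' l : ↑(⋃ y ∈ {y | T.child x y}, T.leavesBelow y), T.mass l :=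
        (ENNReal.tsum_biUnion' (T.pairwiseDisjoint_leavesBelow x)).symm
    _ ≤ ∑' l : T.leavesBelow x, T.mass l := by
        refine ENNReal.tsum_mono_subtype _ (Set.iUnion₂_subset fun y hy l hl => ⟨hl.1, ?_⟩)
        exact hl.2.head hy

theorem tsum_mass_leaves_eq_one (h : IsEmpty T.InfPath) : ∑' x : T.leaves, T.mass x = 1 := by
  refine T.tsum_mass_leaves_le.antisymm ?_
  by_contra! hlt
  rcases exists_finPath_or_infPath (T := T)
    (fun x => ∑' l : T.leavesBelow x, T.mass l < T.mass x)
    (by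
      rw [mass_root]
      exact (ENNReal.tsum_mono_subtype _ (Set.sep_subset _ _)).trans_lt hlt)
    (fun x hx => exists_child_tsum_leavesBelow_lt hx) with ⟨π, hπ⟩ | ⟨π, -⟩
  · refine hπ.not_ge ?_
    exact ENNReal.le_tsum (f := fun l : T.leavesBelow (π.node (Fin.last π.length)) => T.mass l)
      ⟨_, π.leaf, .refl⟩
  · exact h.false π

/-! ### The two probability spaces -/

/-- The possible outcome at the leaf of a path of finite length. -/
def FinPath.outcome (π : T.FinPath) : Outcome G :=
  ⟨π.result, π.result_mem_possibleOutcomes⟩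

theorem fin_mem_finEvent {π : T.FinPath} : MaxPath.fin π ∈ T.finEvent ↔ π ∈ T.finPaths :=
  Function.Injective.mem_set_image fun _ _ => MaxPath.fin.inj

theorem inf_notMem_finEvent {π : T.InfPath} : MaxPath.inf π ∉ T.finEvent := by
  rintro ⟨_, -, h⟩
  cases h

variable (T) in
theorem outcome_image_finPaths : FinPath.outcome '' T.finPaths = finOutcomes G := by
  ext ω
  constructor
  · rintro ⟨π, hπ, rfl⟩
    exact hπ
  · intro hω
    obtain ⟨π, hπ, h⟩ := T.bijOn_result.surjOn ⟨ω.mem, hω⟩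
    exact ⟨π, hπ, Outcome.ext h⟩

variable (T) in
theorem tsum_finEvent (f : T.MaxPath → ℝ≥0∞) :
    ∑' x : T.finEvent, f x = ∑' π : T.finPaths, f (.fin π) :=
  tsum_image f fun _ _ _ _ => MaxPath.fin.inj

variable (T) in
theorem tsum_finOutcomes (f : Outcome G → ℝ≥0∞) :
    ∑' ω : finOutcomes G, f ω = ∑' π : T.finPaths, f π.1.outcome := by
  rw [← T.outcome_image_finPaths, tsum_image f]
  exact fun _ _ _ _ h => FinPath.result_injective (congrArg Outcome.val h)

variable (T) in
theorem tsum_pr_finPaths_le : ∑' π : T.finPaths, pr π.1.choices.val ≤ 1 := by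
  refine le_trans ?_ T.tsum_mass_leaves_le
  refine ENNReal.tsum_comp_le_tsum_of_injective (f := fun π : T.finPaths =>
    (⟨π.1.node (Fin.last _), π.1.leaf⟩ : T.leaves)) (fun π π' h => ?_) (fun x => T.mass x)
  exact Subtype.ext (FinPath.choices_injective (congrArg (fun x : T.leaves => T.label x) h))

theorem tsum_pr_finPaths_eq_one (h : ¬ T.infEvent.Nonempty) :
    ∑' π : T.finPaths, pr π.1.choices.val = 1 := by
  have hall : ∀ x, x ∈ T.finEvent := fun x => by_contra fun hx => h ⟨x, hx⟩
  refine T.tsum_pr_finPaths_le.antisymm ?_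
  rw [← tsum_mass_leaves_eq_one (T := T) ⟨fun π => inf_notMem_finEvent (hall (.inf π))⟩]
  refine ENNReal.tsum_le_tsum_comp_of_surjective (f := fun π : T.finPaths =>
    (⟨π.1.node (Fin.last _), π.1.leaf⟩ : T.leaves)) (fun x => ?_) (fun x => T.mass x)
  obtain ⟨π, hπ⟩ := exists_finPath x.2
  exact ⟨⟨π, fin_mem_finEvent.1 (hall _)⟩, Subtype.ext hπ⟩

variable (T) in
/-- There are countably many finite paths: they have positive probabilities of sum at most `1`. -/
theorem countable_finPaths : T.finPaths.Countable := by
  have h : (Function.support fun π : T.finPaths => T.mass (π.1.node (Fin.last _))).Countable :=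
    Summable.countable_support_ennreal (T.tsum_pr_finPaths_le.trans_lt ENNReal.one_lt_top).ne
  rw [Function.support_eq_univ fun π : T.finPaths =>
    (T.mass_pos (π.1.node (Fin.last _))).ne'] at h
  exact Set.countable_coe_iff.1 (Set.countable_univ_iff.1 h)

end ChaseTree

open Classical in
/-- The stable models of a finite outcome, and `none` for an infinite one. -/
noncomputable def Outcome.key (ω : Outcome G) : Option (Set (Set (GAtom L))) :=
  if ω.val.Finite then some (sms ω.val) else none

theorem Outcome.key_of_mem_finOutcomes {ω : Outcome G} (hω : ω ∈ finOutcomes G) :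
    ω.key = some (sms ω.val) := if_pos hω

theorem Outcome.mem_finOutcomes_iff (ω : Outcome G) :
    ω ∈ finOutcomes G ↔ ω.key ≠ none := by
  simp [finOutcomes, Outcome.key]

namespace ChaseTree

variable {N : Type*} {T : ChaseTree G N}

open Classical in
/-- The stable models at the leaf of a finite path, and `none` for the other maximal paths. -/
noncomputable def MaxPath.key : T.MaxPath → Option (Set (Set (GAtom L)))
  | .fin π => if π.result.Finite then some (sms π.result) else none
  | .inf _ => none

theorem MaxPath.mem_finEvent_iff (x : T.MaxPath) : x ∈ T.finEvent ↔ x.key ≠ none := by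
  cases x with
  | fin π => simp [fin_mem_finEvent, finPaths, key]
  | inf π => simp [inf_notMem_finEvent, key]

theorem MaxPath.key_fin {π : T.FinPath} (hπ : π ∈ T.finPaths) :
    (MaxPath.fin π).key = some (sms π.result) := if_pos hπ

theorem FinPath.key_outcome (π : T.FinPath) : π.outcome.key = (MaxPath.fin π).key := rfl

variable (T) in
theorem range_key : Set.range (MaxPath.key (T := T)) = Set.range (Outcome.key (G := G)) := by
  ext k
  constructor
  · rintro ⟨x, rfl⟩
    cases hx : x.key with
    | none =>
      have hinf : x ∈ T.infEvent := fun h => x.mem_finEvent_iff.1 h hx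
      obtain ⟨ω, hω⟩ := T.infOutcomes_nonempty_iff.2 ⟨x, hinf⟩
      exact ⟨ω, if_neg hω⟩
    | some k =>
      obtain ⟨π, -, rfl⟩ := x.mem_finEvent_iff.2 (by simp [hx])
      exact ⟨π.outcome, π.key_outcome.trans hx⟩
  · rintro ⟨ω, rfl⟩
    by_cases hω : ω ∈ finOutcomes G
    · rw [← T.outcome_image_finPaths] at hω
      obtain ⟨π, -, rfl⟩ := hω
      exact ⟨.fin π, rfl⟩
    · obtain ⟨x, hx⟩ := T.infOutcomes_nonempty_iff.1 ⟨ω, hω⟩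
      refine ⟨x, ?_⟩
      rw [not_not.1 (x.mem_finEvent_iff.not.1 hx), not_not.1 (ω.mem_finOutcomes_iff.not.1 hω)]

variable (T) in
theorem countable_range_key : (Set.range (MaxPath.key (T := T))).Countable := by
  have h := (((T.countable_finPaths.image MaxPath.fin).image MaxPath.key).insert none)
  refine h.mono ?_
  rintro _ ⟨x, rfl⟩
  by_cases hx : x ∈ T.finEvent
  · exact .inr ⟨x, hx, rfl⟩
  · exact .inl (not_not.1 (x.mem_finEvent_iff.not.1 hx))

variable (T) in
theorem measurableSet_path_iff (A : Set T.MaxPath) :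
    MeasurableSet A ↔ ∀ x y : T.MaxPath, x.key = y.key → x ∈ A → y ∈ A := by
  rw [← measurableSet_generateFrom_cells_iff MaxPath.mem_finEvent_iff T.countable_range_key]
  have hcells : T.pathClasses = {E | Maximal (fun E : Set T.MaxPath => E ⊆ T.finEvent ∧
      ∀ x ∈ E, ∀ y ∈ E, x.key = y.key) E} := by
    ext E
    rw [pathClasses, Set.mem_ofPred_eq, Set.mem_ofPred_eq]
    refine iff_of_eq (congrArg (fun p => Maximal p E) (funext fun E' => propext ?_))
    refine and_congr_right fun hE' => ⟨fun h x hx y hy => ?_, fun h π π' hπ hπ' => ?_⟩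
    · obtain ⟨π, hπ, rfl⟩ := hE' hx
      obtain ⟨π', hπ', rfl⟩ := hE' hy
      rw [MaxPath.key_fin hπ, MaxPath.key_fin hπ', h π π' hx hy]
    · have := h _ hπ _ hπ'
      rw [MaxPath.key_fin (fin_mem_finEvent.1 (hE' hπ)),
        MaxPath.key_fin (fin_mem_finEvent.1 (hE' hπ'))] at this
      exact Option.some.inj this
  rw [← hcells]
  rfl

theorem measurableSet_outcome_iff (T : ChaseTree G N) (A : Set (Outcome G)) :
    MeasurableSet A ↔ ∀ ω ω' : Outcome G, ω.key = ω'.key → ω ∈ A → ω' ∈ A := by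
  rw [← measurableSet_generateFrom_cells_iff Outcome.mem_finOutcomes_iff
    (T.range_key ▸ T.countable_range_key)]
  have hcells : outcomeClasses G = {E | Maximal (fun E : Set (Outcome G) => E ⊆ finOutcomes G ∧
      ∀ x ∈ E, ∀ y ∈ E, x.key = y.key) E} := by
    ext E
    rw [outcomeClasses, Set.mem_ofPred_eq, Set.mem_ofPred_eq]
    refine iff_of_eq (congrArg (fun p => Maximal p E) (funext fun E' => propext ?_))
    refine and_congr_right fun hE' => forall₂_congr fun ω hω => forall₂_congr fun ω' hω' => ?_
    rw [Outcome.key_of_mem_finOutcomes (hE' hω), Outcome.key_of_mem_finOutcomes (hE' hω'),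
      Option.some_inj]
  rw [← hcells]
  rfl

/-- On measurable sets of paths, `transfer` collects the outcomes whose key occurs in the set. -/
theorem transfer_eq {A : Set T.MaxPath} (hA : MeasurableSet A) :
    T.transfer A = {ω | ∃ x ∈ A, x.key = ω.key} := by
  rw [measurableSet_path_iff] at hA
  ext ω
  constructor
  · rintro (⟨π, hπ, hA', h⟩ | ⟨hω, x, hxA, hx⟩)
    · obtain rfl : ω = π.outcome := Outcome.ext h
      exact ⟨_, hA', rfl⟩
    · refine ⟨x, hxA, ?_⟩
      rw [not_not.1 (x.mem_finEvent_iff.not.1 hx), not_not.1 (ω.mem_finOutcomes_iff.not.1 hω)]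
  · rintro ⟨x, hxA, hx⟩
    by_cases hω : ω ∈ finOutcomes G
    · rw [← T.outcome_image_finPaths] at hω
      obtain ⟨π, hπ, rfl⟩ := hω
      exact .inl ⟨π, hπ, hA _ _ hx hxA, rfl⟩
    · refine .inr ⟨hω, x, hxA, fun h => ?_⟩
      rw [x.mem_finEvent_iff, hx, ← ω.mem_finOutcomes_iff] at h
      exact hω h

theorem fin_mem_iff_outcome_mem_transfer {A : Set T.MaxPath} {π : T.FinPath}
    (hπ : π ∈ T.finPaths) : π.outcome ∈ T.transfer A ↔ MaxPath.fin π ∈ A := by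
  constructor
  · rintro (⟨π', -, hA, h⟩ | ⟨h, -⟩)
    · rwa [FinPath.result_injective (show π.result = π'.result from h)]
    · exact absurd hπ h
  · exact fun h => .inl ⟨π, hπ, h, rfl⟩

theorem transfer_inter_infOutcomes_nonempty_iff {A : Set T.MaxPath} :
    (T.transfer A ∩ (finOutcomes G)ᶜ).Nonempty ↔ (A ∩ T.finEventᶜ).Nonempty := by
  constructor
  · rintro ⟨ω, ⟨π, hπ, -, h⟩ | ⟨-, h⟩, hω⟩
    · exact absurd (show ω.val.Finite from h ▸ hπ) hω
    · exact h
  · intro h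
    obtain ⟨ω, hω⟩ := T.infOutcomes_nonempty_iff.2 (h.mono Set.inter_subset_right)
    exact ⟨ω, .inr ⟨hω, h⟩, hω⟩

variable (T) in
theorem tsum_pr_finOutcomes :
    ∑' ω : finOutcomes G, pr ω.1.val = ∑' π : T.finPaths, pr π.1.choices.val :=
  (T.tsum_finOutcomes fun ω => pr ω.val).trans (tsum_congr fun _ => G.pr_program _)

/-- On measurable sets both measures are the sum of the masses of the finite members, plus the
remaining mass if the set meets the atom of the others; the bijection between finite paths and
finite outcomes preserves masses, and `transfer` preserves whether the atom is met. -/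
theorem outcomeMeasure_transfer {A : Set T.MaxPath} (hA : MeasurableSet A)
    (hB : MeasurableSet (T.transfer A)) : outcomeMeasure G (T.transfer A) = T.pathMeasure A := by
  classical
  have hA' := (T.measurableSet_path_iff A).1 hA
  have hB' := (T.measurableSet_outcome_iff _).1 hB
  rw [outcomeMeasure, pathMeasure, completedMeasure_apply hA, completedMeasure_apply hB]
  · congr 1
    · rw [T.tsum_finEvent fun x => if x ∈ A then x.pr else 0,
        T.tsum_finOutcomes fun ω => if ω ∈ T.transfer A then pr ω.val else 0]
      refine tsum_congr fun π => ?_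
      simp only [fin_mem_iff_outcome_mem_transfer π.2]
      exact if_congr Iff.rfl (G.pr_program _) rfl
    · rw [T.tsum_pr_finOutcomes, T.tsum_finEvent]
      exact if_congr transfer_inter_infOutcomes_nonempty_iff rfl rfl
  · rintro ⟨ω, hω, hωF⟩ ω' hω'
    refine hB' ω ω' ?_ hω
    rw [not_not.1 (ω.mem_finOutcomes_iff.not.1 hωF), not_not.1 (ω'.mem_finOutcomes_iff.not.1 hω')]
  · rintro ⟨x, hx, hxF⟩ y hy
    refine hA' x y ?_ hx
    rw [not_not.1 (x.mem_finEvent_iff.not.1 hxF), not_not.1 (y.mem_finEvent_iff.not.1 hy)]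

variable (T) in
theorem isProbabilityMeasure_pathMeasure : IsProbabilityMeasure T.pathMeasure := by
  apply isProbabilityMeasure_completedMeasure <;> rw [T.tsum_finEvent]
  · exact T.tsum_pr_finPaths_le
  · exact tsum_pr_finPaths_eq_one

/-- If all outcomes are finite then so are all maximal paths, hence no mass is lost. -/
theorem isProbabilityMeasure_outcomeMeasure (T : ChaseTree G N) :
    IsProbabilityMeasure (outcomeMeasure G) := by
  apply isProbabilityMeasure_completedMeasure <;> rw [T.tsum_pr_finOutcomes]
  · exact T.tsum_pr_finPaths_le
  · exact fun h => tsum_pr_finPaths_eq_one (T.infOutcomes_nonempty_iff.not.1 h)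

end ChaseTree

end GDatalog

open GDatalog in
theorem mainTheorem1 {C : Type u} (L : Vocabulary.{u, v, w} C)
    (P : Set (Rule L)) (hP : P.Finite)
    (D : Set (Fact L)) (hD : D.Finite) (hedb : ∀ α ∈ D, α.rel ∈ edb P)
    (G : Grounder (withDatabase P D))
    {N : Type*} (T : ChaseTree G N) :
    -- the finite paths correspond bijectively to the finite possible outcomes
    Set.BijOn ChaseTree.FinPath.result T.finPaths {Γ | Γ ∈ G.possibleOutcomes ∧ Γ.Finite} ∧
    -- both semantics give probability spaces
    IsProbabilityMeasure (outcomeMeasure G) ∧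
    IsProbabilityMeasure T.pathMeasure ∧
    -- the bijection induces an isomorphism of the σ-algebras that preserves the measures
    (∃ e : {A : Set T.MaxPath // MeasurableSet A} ≃o {B : Set (Outcome G) // MeasurableSet B},
      (∀ A, (e A).1 = T.transfer A.1) ∧
      (∀ A, outcomeMeasure G (e A).1 = T.pathMeasure A.1)) ∧
    -- all paths of finite length are finite if the grounder maps finite sets to finite sets
    ((∀ S, S.val.Finite → (G.toFun S).Finite) → T.finPaths = Set.univ) := by
  refine ⟨T.bijOn_result, T.isProbabilityMeasure_outcomeMeasure,
    T.isProbabilityMeasure_pathMeasure, ?_, ChaseTree.finPaths_eq_univ⟩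
  let e := saturatedOrderIso T.measurableSet_path_iff T.measurableSet_outcome_iff T.range_key
  have he : ∀ A, (e A).1 = T.transfer A.1 := fun A => (ChaseTree.transfer_eq A.2).symm
  refine ⟨e, he, fun A => ?_⟩
  rw [he]
  exact ChaseTree.outcomeMeasure_transfer A.2 (he A ▸ (e A).2)
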